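/- Let $\tau$ be a relational signature (with equality available in all formulas). All structures are finite with nonempty domain, and $\log n=\lceil\log_2 n\rceil$. **The logic.** Fix infinitely many relation variables of each arity $\ge 1$. Let $\mathscr L_{\infty\omega}[\tau]$ be the infinitary first-order logic over $\tau$ (negation, conjunctions and disjunctions of arbitrary sets of formulas, $\exists x$, $\forall x$) in which atoms $X\vec x$ with relation variables $X$ are also allowed, and let $\mathscr L^{\omega}_{\infty\omega}$ consist of those of its formulas that contain only finitely many element variables. Let $\mathcal L$ be the smallest class of formulas that contains $\mathscr L^{\omega}_{\infty\omega}$ and is closed under binary $\wedge$ and $\vee$ and under the log-quantifiers $\exists^{\log^k}X$ and $\forall^{\log^k}X$ for all $k>0$ and all relation variables $X$. Here $\mathscr A\models\exists^{\log^k}X\,\varphi$ means that there is $S\subseteq A^{\mathrm{arity}(X)}$ with $|S|\le(\log|A|)^k$ such that $\mathscr A\models\varphi[X/S]$, and $\forall^{\log^k}$ is its dual. The log-quantifier rank of a formula is the maximal nesting depth of log-quantifiers in it. For $m\ge0$ and $r,k,s>0$, let $\mathcal L^{m,r,k,s}$ be the set of those $\varphi\in\mathcal L$ whose log-quantifier rank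 is at most $m$, all of whose relation variables (free or bound) have arity at most $r$, all of whose log-quantifiers $\exists^{\log^j},\forall^{\log^j}$ have $j\le k$, and in which at most $s$ element variables occur (free or bound). A sentence is a formula without free element variables and without free relation variables. **The game.** Let $\mathscr A,\mathscr B$ be $\tau$-structures with domains $A$ and $B$. The game $\mathrm G^{m,r,k,s}(\mathscr A,\mathscr B)$ is played by a spoiler and a duplicator. First the spoiler chooses $m'\le m$. Then $m'$ relation moves are played. In the $i$-th one the spoiler chooses $1\le r_i\le r$ and $1\le k_i\le k$ and one of the two structures. If she chooses $\mathscr A$, she then chooses $R_i\subseteq A^{r_i}$ with $|R_i|\le(\log|A|)^{k_i}$ and the duplicator answers with some $S_i\subseteq B^{r_i}$ with $|S_i|\le(\log|B|)^{k_i}$; if she chooses $\mathscr B$, the roles of $\mathscr A$ and $\mathscr B$ are exchanged. Finally the $s$-pebble game is played on $\langle\mathscr A,R_1,\dots,R_{m'}\rangle$ and $\langle\mathscr B,S_1,\dots,S_{m'}\rangle$: there are $s$ pairs of pebbles, initially off the board; in each move the spoiler either passes or places one pebble (a new one, or one already on the board) on an element of one of the structures, and then the duplicator places the other pebble of this pair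 on an element of the other structure. The duplicator wins the play if at every stage (including the initial one) the correspondence between the pebbled elements is a partial isomorphism between the two expanded structures. She wins the game if she has a winning strategy. **Claim.** For all $m\ge0$ and $r,k,s>0$, $\mathrm G^{m,r,k,s}$ is an Ehrenfeucht–Fraïssé game for $\mathcal L^{m,r,k,s}$: for every relational signature $\tau$ and all finite $\tau$-structures $\mathscr A,\mathscr B$ with nonempty domains, $\mathscr A$ and $\mathscr B$ satisfy the same sentences of $\mathcal L^{m,r,k,s}[\tau]$ if and only if the duplicator wins $\mathrm G^{m,r,k,s}(\mathscr A,\mathscr B)$. -/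

import Mathlib

universe u v w u₁ u₂

namespace LogGame

/-! ## Syntax -/

/-- A relation variable: it has a nonzero arity, and there are infinitely many of every arity. -/
structure RelVar where
  arity : ℕ+
  index : ℕ
deriving DecidableEq

/-- Formulas of the infinitary logic `L_∞ω` over the relational signature `L`, with element
variables named by natural numbers and with relation variables. -/
inductive InfFormula (L : FirstOrder.Language.{u, v}) : Type (max v (w + 1)) where
  | eq (x y : ℕ) : InfFormula L
  | rel {n : ℕ} (P : L.Relations n) (x : Fin n → ℕ) : InfFormula L
  | var (X : RelVar) (x : Fin X.arity → ℕ) : InfFormula L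
  | not (φ : InfFormula L) : InfFormula L
  | conj {ι : Type w} (φ : ι → InfFormula L) : InfFormula L
  | disj {ι : Type w} (φ : ι → InfFormula L) : InfFormula L
  | ex (x : ℕ) (φ : InfFormula L) : InfFormula L
  | all (x : ℕ) (φ : InfFormula L) : InfFormula L

namespace InfFormula

variable {L : FirstOrder.Language.{u, v}}

/-- The element variables that occur in a formula, free or bound. -/
def elemVars : InfFormula.{u, v, w} L → Set ℕ
  | .eq x y => {x, y}
  | .rel _ x => Set.range x
  | .var _ x => Set.range x
  | .not φ => φ.elemVars
  | .conj φ => ⋃ i, (φ i).elemVars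
  | .disj φ => ⋃ i, (φ i).elemVars
  | .ex x φ => insert x φ.elemVars
  | .all x φ => insert x φ.elemVars

/-- The free element variables of a formula. -/
def freeVars : InfFormula.{u, v, w} L → Set ℕ
  | .eq x y => {x, y}
  | .rel _ x => Set.range x
  | .var _ x => Set.range x
  | .not φ => φ.freeVars
  | .conj φ => ⋃ i, (φ i).freeVars
  | .disj φ => ⋃ i, (φ i).freeVars
  | .ex x φ => φ.freeVars \ {x}
  | .all x φ => φ.freeVars \ {x}

/-- The relation variables that occur in a formula (there is nothing here that binds them). -/
def relVars : InfFormula.{u, v, w} L → Set RelVar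
  | .eq _ _ => ∅
  | .rel _ _ => ∅
  | .var X _ => {X}
  | .not φ => φ.relVars
  | .conj φ => ⋃ i, (φ i).relVars
  | .disj φ => ⋃ i, (φ i).relVars
  | .ex _ φ => φ.relVars
  | .all _ φ => φ.relVars

end InfFormula

/-- Formulas built from those of `L_∞ω` by log-quantifiers `∃^{log^k} X`, `∀^{log^k} X` with
`k > 0`, and by binary conjunctions and disjunctions. (The restriction to finitely many element
variables is part of `LogFormula.Mem` below.) -/
inductive LogFormula (L : FirstOrder.Language.{u, v}) : Type (max v (w + 1)) where
  | base (φ : InfFormula.{u, v, w} L) : LogFormula L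
  | exLog (k : ℕ+) (X : RelVar) (φ : LogFormula L) : LogFormula L
  | allLog (k : ℕ+) (X : RelVar) (φ : LogFormula L) : LogFormula L
  | and (φ ψ : LogFormula L) : LogFormula L
  | or (φ ψ : LogFormula L) : LogFormula L

namespace LogFormula

variable {L : FirstOrder.Language.{u, v}}

/-- The element variables that occur in a formula, free or bound. -/
def elemVars : LogFormula.{u, v, w} L → Set ℕ
  | .base φ => φ.elemVars
  | .exLog _ _ φ => φ.elemVars
  | .allLog _ _ φ => φ.elemVars
  | .and φ ψ => φ.elemVars ∪ ψ.elemVars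
  | .or φ ψ => φ.elemVars ∪ ψ.elemVars

/-- The free element variables of a formula. -/
def freeVars : LogFormula.{u, v, w} L → Set ℕ
  | .base φ => φ.freeVars
  | .exLog _ _ φ => φ.freeVars
  | .allLog _ _ φ => φ.freeVars
  | .and φ ψ => φ.freeVars ∪ ψ.freeVars
  | .or φ ψ => φ.freeVars ∪ ψ.freeVars

/-- The relation variables of a formula, free or bound by a log-quantifier. -/
def relVars : LogFormula.{u, v, w} L → Set RelVar
  | .base φ => φ.relVars
  | .exLog _ X φ => insert X φ.relVars
  | .allLog _ X φ => insert X φ.relVars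
  | .and φ ψ => φ.relVars ∪ ψ.relVars
  | .or φ ψ => φ.relVars ∪ ψ.relVars

/-- The free relation variables of a formula. -/
def freeRelVars : LogFormula.{u, v, w} L → Set RelVar
  | .base φ => φ.relVars
  | .exLog _ X φ => φ.freeRelVars \ {X}
  | .allLog _ X φ => φ.freeRelVars \ {X}
  | .and φ ψ => φ.freeRelVars ∪ ψ.freeRelVars
  | .or φ ψ => φ.freeRelVars ∪ ψ.freeRelVars

/-- The log-quantifier rank. -/
def lqr : LogFormula.{u, v, w} L → ℕ
  | .base _ => 0
  | .exLog _ _ φ => φ.lqr + 1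
  | .allLog _ _ φ => φ.lqr + 1
  | .and φ ψ => max φ.lqr ψ.lqr
  | .or φ ψ => max φ.lqr ψ.lqr

/-- The height: the largest `k` such that a quantifier `∃^{log^k}` or `∀^{log^k}` occurs. -/
def height : LogFormula.{u, v, w} L → ℕ
  | .base _ => 0
  | .exLog k _ φ => max (k : ℕ) φ.height
  | .allLog k _ φ => max (k : ℕ) φ.height
  | .and φ ψ => max φ.height ψ.height
  | .or φ ψ => max φ.height ψ.height

/-- The maximal variable arity. -/
noncomputable def mva (φ : LogFormula.{u, v, w} L) : ℕ∞ :=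
  ⨆ X ∈ φ.relVars, ((X.arity : ℕ) : ℕ∞)

/-- Membership in the logic with parameters `m, r, k, s`. -/
structure Mem (φ : LogFormula.{u, v, w} L) (m r k s : ℕ) : Prop where
  lqr_le : φ.lqr ≤ m
  mva_le : φ.mva ≤ r
  height_le : φ.height ≤ k
  elemVars_le : φ.elemVars.encard ≤ s

/-- Sentences have no free element variables and no free relation variables. -/
def IsSentence (φ : LogFormula.{u, v, w} L) : Prop :=
  φ.freeVars = ∅ ∧ φ.freeRelVars = ∅

end LogFormula

/-! ## Semantics -/

/-- `|R| ≤ log^k |A|`, where `log n = ⌈log₂ n⌉`. It is used for finite `A` only. -/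
def LogBounded {A : Type u₁} {n : ℕ} (k : ℕ) (R : Set (Fin n → A)) : Prop :=
  R.ncard ≤ Nat.clog 2 (Nat.card A) ^ k

/-- An interpretation of the relation variables on `A`. -/
abbrev RelEnv (A : Type u₁) : Type u₁ :=
  (X : RelVar) → Set (Fin X.arity → A)

/-- Satisfaction for `L_∞ω`. -/
def InfFormula.Sat {L : FirstOrder.Language.{u, v}} {A : Type u₁} [L.Structure A] :
    InfFormula.{u, v, w} L → RelEnv A → (ℕ → A) → Prop
  | .eq x y, _, α => α x = α y
  | .rel P x, _, α => FirstOrder.Language.Structure.RelMap P (fun i => α (x i))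
  | .var X x, ρ, α => (fun i => α (x i)) ∈ ρ X
  | .not φ, ρ, α => ¬ φ.Sat ρ α
  | .conj φ, ρ, α => ∀ i, (φ i).Sat ρ α
  | .disj φ, ρ, α => ∃ i, (φ i).Sat ρ α
  | .ex x φ, ρ, α => ∃ a : A, φ.Sat ρ (Function.update α x a)
  | .all x φ, ρ, α => ∀ a : A, φ.Sat ρ (Function.update α x a)

/-- Satisfaction for formulas with log-quantifiers. -/
def LogFormula.Sat {L : FirstOrder.Language.{u, v}} {A : Type u₁} [L.Structure A] :
    LogFormula.{u, v, w} L → RelEnv A → (ℕ → A) → Prop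
  | .base φ, ρ, α => φ.Sat ρ α
  | .exLog k X φ, ρ, α =>
      ∃ S : Set (Fin X.arity → A), LogBounded k S ∧ φ.Sat (Function.update ρ X S) α
  | .allLog k X φ, ρ, α =>
      ∀ S : Set (Fin X.arity → A), LogBounded k S → φ.Sat (Function.update ρ X S) α
  | .and φ ψ, ρ, α => φ.Sat ρ α ∧ ψ.Sat ρ α
  | .or φ ψ, ρ, α => φ.Sat ρ α ∨ ψ.Sat ρ α

/-- Truth in a structure; for a sentence the assignments play no role. -/
def Models {L : FirstOrder.Language.{u, v}} (A : Type u₁) [L.Structure A]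
    (φ : LogFormula.{u, v, w} L) : Prop :=
  ∀ (ρ : RelEnv A) (α : ℕ → A), φ.Sat ρ α

/-- `A` and `B` satisfy the same sentences of the logic with parameters `m, r, k, s`. The
universe `w` bounds the size of the conjunctions and disjunctions. -/
def LogicEquiv (L : FirstOrder.Language.{u, v}) (A : Type u₁) (B : Type u₂) [L.Structure A] [L.Structure B]
    (m r k s : ℕ) : Prop :=
  ∀ φ : LogFormula.{u, v, w} L, φ.IsSentence → φ.Mem m r k s → (Models A φ ↔ Models B φ)

/-! ## The pebble game on expanded structures -/

/-- A list of pairs of relations `(R₁, S₁), (R₂, S₂), …` of equal arities, with `Rᵢ` on `A` and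
`Sᵢ` on `B`: it expands `A` and `B` to `⟨A, R₁, R₂, …⟩` and `⟨B, S₁, S₂, …⟩`. -/
abbrev Expansion (A : Type u₁) (B : Type u₂) : Type (max u₁ u₂) :=
  List (Σ n : ℕ, Set (Fin n → A) × Set (Fin n → B))

/-- The set `C` of pairs is (the graph of) a partial isomorphism between the structures
`A` and `B`, expanded by `E`. -/
structure IsPartialIso (L : FirstOrder.Language.{u, v}) {A : Type u₁} {B : Type u₂}
    [L.Structure A] [L.Structure B] (E : Expansion A B) (C : Set (A × B)) : Prop where
  bij : ∀ p ∈ C, ∀ q ∈ C, p.1 = q.1 ↔ p.2 = q.2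
  rel : ∀ {n : ℕ} (P : L.Relations n) (t : Fin n → A × B), (∀ i, t i ∈ C) →
    (FirstOrder.Language.Structure.RelMap P (fun i => (t i).1) ↔
      FirstOrder.Language.Structure.RelMap P (fun i => (t i).2))
  exp : ∀ Q ∈ E, ∀ t : Fin Q.1 → A × B, (∀ i, t i ∈ C) →
    ((fun i => (t i).1) ∈ Q.2.1 ↔ (fun i => (t i).2) ∈ Q.2.2)

/-- A move of the spoiler: she passes, or she places the pebble number `i`, which is off the board
or already on it, on an element of `A` or of `B`. -/
inductive SpoilerMove (s : ℕ) (A : Type u₁) (B : Type u₂) : Type (max u₁ u₂) where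
  | pass : SpoilerMove s A B
  | left (i : Fin s) (a : A) : SpoilerMove s A B
  | right (i : Fin s) (b : B) : SpoilerMove s A B

/-- A strategy of the duplicator: given the earlier moves of the spoiler (latest first) and her
present move, it names the element on which the partner of her pebble is placed. -/
structure DuplicatorStrategy (s : ℕ) (A : Type u₁) (B : Type u₂) : Type (max u₁ u₂) where
  replyB : List (SpoilerMove s A B) → Fin s → A → B
  replyA : List (SpoilerMove s A B) → Fin s → B → A

/-- The pairs of elements covered by the `s` pairs of pebbles (`none`: off the board) after the
given moves of the spoiler (latest first), if the duplicator follows her strategy. -/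
def DuplicatorStrategy.position {s : ℕ} {A : Type u₁} {B : Type u₂}
    (σ : DuplicatorStrategy s A B) : List (SpoilerMove s A B) → Fin s → Option (A × B)
  | [] => fun _ => none
  | .pass :: h => σ.position h
  | .left i a :: h => Function.update (σ.position h) i (some (a, σ.replyB h i a))
  | .right i b :: h => Function.update (σ.position h) i (some (σ.replyA h i b, b))

/-- The duplicator has a winning strategy in the `s`-pebble game on `A` and `B` expanded by `E`:
whatever the spoiler plays, at every stage the pebbled elements form a partial isomorphism. -/
def WinsPebbleGame (L : FirstOrder.Language.{u, v}) {A : Type u₁} {B : Type u₂}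
    [L.Structure A] [L.Structure B] (s : ℕ) (E : Expansion A B) : Prop :=
  ∃ σ : DuplicatorStrategy s A B, ∀ h : List (SpoilerMove s A B),
    IsPartialIso L E {p | ∃ i, σ.position h i = some p}

/-! ## The game with relation moves -/

/-- The duplicator can win when exactly `m` more relation moves are played, followed by the
`s`-pebble game, on `A` and `B` already expanded by `E`. -/
def WinsRelationMoves (L : FirstOrder.Language.{u, v}) {A : Type u₁} {B : Type u₂}
    [L.Structure A] [L.Structure B] (r k s : ℕ) : ℕ → Expansion A B → Prop
  | 0, E => WinsPebbleGame L s E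
  | m + 1, E => ∀ r' k' : ℕ, 0 < r' → r' ≤ r → 0 < k' → k' ≤ k →
      (∀ R : Set (Fin r' → A), LogBounded k' R →
        ∃ S : Set (Fin r' → B), LogBounded k' S ∧
          WinsRelationMoves L r k s m (⟨r', R, S⟩ :: E)) ∧
      (∀ S : Set (Fin r' → B), LogBounded k' S →
        ∃ R : Set (Fin r' → A), LogBounded k' R ∧
          WinsRelationMoves L r k s m (⟨r', R, S⟩ :: E))

/-- The duplicator wins the game with parameters `m, r, k, s` on `A` and `B`: the spoiler first
chooses the number `m' ≤ m` of relation moves. -/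
def DuplicatorWins (L : FirstOrder.Language.{u, v}) (A : Type u₁) (B : Type u₂)
    [L.Structure A] [L.Structure B] (m r k s : ℕ) : Prop :=
  ∀ m' ≤ m, WinsRelationMoves L r k s m' ([] : Expansion A B)

end LogGame

namespace LogGame

/-! Log-quantifiers correspond to relation moves, and first-order quantifiers to pebble moves.

From a winning strategy to agreement: in `WinsRelationMoves.sat_iff` the duplicator's answer to a
witness set is a witness set of the same logarithmic bound on the other side. Subformulas of smaller
rank leave relation moves over, and the spoiler wastes these on empty relations
(`WinsRelationMoves.of_succ`). What remains is a formula with at most `s` element variables. Each of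
these owns a pebble, and quantifying a variable means placing or moving its pebble
(`InfFormula.sat_iff_of_strategy`).

From agreement to a winning strategy, by contraposition: if the duplicator does not win, some
formula holds on the left and fails on the right (`exists_separates`). For the pebble game, "no
formula separates the two sides" is an invariant that the duplicator can maintain forever: if every
answer broke it, the separating formulas, one per answer, would combine into a separating formula
for the current position (`Inseparable.forth`, `Inseparable.back`). Relation moves are handled by
induction on their number, combining the formulas for all answers under one log-quantifier. The
structures are finite, so all conjunctions and disjunctions used are finite, whatever the universe
`w`. -/

theorem InfFormula.freeVars_subset_elemVars {L : FirstOrder.Language.{u, v}}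
    (φ : InfFormula.{u, v, w} L) : φ.freeVars ⊆ φ.elemVars := by
  induction φ with
  | eq | rel | var => exact subset_rfl
  | not φ ih => exact ih
  | conj φ ih | disj φ ih => exact Set.iUnion_mono ih
  | ex x φ ih | all x φ ih => exact Set.sdiff_subset.trans (ih.trans (Set.subset_insert _ _))

/-! ### A winning duplicator forces agreement on sentences. -/

section Soundness

variable {L : FirstOrder.Language.{u, v}} {A : Type u₁} {B : Type u₂}
  [L.Structure A] [L.Structure B]

theorem IsPartialIso.mono {E E' : Expansion A B} {C : Set (A × B)} (hE : E ⊆ E')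
    (h : IsPartialIso L E' C) : IsPartialIso L E C :=
  ⟨h.bij, h.rel, fun Q hQ => h.exp Q (hE hQ)⟩

theorem WinsPebbleGame.mono {s : ℕ} {E E' : Expansion A B} (hE : E ⊆ E')
    (h : WinsPebbleGame L s E') : WinsPebbleGame L s E :=
  h.imp fun _ hσ l => (hσ l).mono hE

theorem logBounded_empty {n k : ℕ} : LogBounded k (∅ : Set (Fin n → A)) := by
  simp [LogBounded]

/-- The spoiler may waste a relation move, so a duplicator who survives one more relation move
survives one less. -/
theorem WinsRelationMoves.of_succ {r k s : ℕ} (hr : 0 < r) (hk : 0 < k) {m : ℕ}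
    {E : Expansion A B} (h : WinsRelationMoves L r k s (m + 1) E) :
    WinsRelationMoves L r k s m E := by
  induction m generalizing E with
  | zero =>
    -- The wasted move plays the empty unary relation; it is legal because `r` and `k` are positive.
    obtain ⟨S, -, hS⟩ := (h 1 1 one_pos hr one_pos hk).1 ∅ logBounded_empty
    exact WinsPebbleGame.mono (List.subset_cons_self _ _) hS
  | succ m ih =>
    intro r' k' hr' hr'r hk' hk'k
    obtain ⟨h₁, h₂⟩ := h r' k' hr' hr'r hk' hk'k
    refine ⟨fun R hR => ?_, fun S hS => ?_⟩
    · obtain ⟨S, hS, hw⟩ := h₁ R hR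
      exact ⟨S, hS, ih hw⟩
    · obtain ⟨R, hR, hw⟩ := h₂ S hS
      exact ⟨R, hR, ih hw⟩

theorem WinsRelationMoves.winsPebbleGame {r k s : ℕ} (hr : 0 < r) (hk : 0 < k) {m : ℕ}
    {E : Expansion A B} (h : WinsRelationMoves L r k s m E) : WinsPebbleGame L s E := by
  induction m with
  | zero => exact h
  | succ m ih => exact ih (h.of_succ hr hk)

/-- Relation environments on the two structures that interpret the variables in `N` by
corresponding relations of the expansion. -/
def EnvsAgree (E : Expansion A B) (N : Set RelVar) (ρ : RelEnv A) (ρ' : RelEnv B) : Prop :=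
  ∀ X ∈ N, (⟨X.arity, ρ X, ρ' X⟩ : Σ n : ℕ, Set (Fin n → A) × Set (Fin n → B)) ∈ E

theorem EnvsAgree.mono {E : Expansion A B} {N N' : Set RelVar} {ρ : RelEnv A} {ρ' : RelEnv B}
    (h : EnvsAgree E N' ρ ρ') (hN : N ⊆ N') : EnvsAgree E N ρ ρ' :=
  fun X hX => h X (hN hX)

/-- Rebinding a variable is harmless here: its old pair stays in the expansion, but agreement only
concerns current interpretations. -/
theorem EnvsAgree.update {E : Expansion A B} {N : Set RelVar} {ρ : RelEnv A} {ρ' : RelEnv B}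
    {X : RelVar} (h : EnvsAgree E (N \ {X}) ρ ρ') (R : Set (Fin X.arity → A))
    (S : Set (Fin X.arity → B)) :
    EnvsAgree (⟨X.arity, R, S⟩ :: E) N (Function.update ρ X R) (Function.update ρ' X S) := by
  intro Y hY
  by_cases hYX : Y = X
  · subst hYX
    simp
  · simpa [Function.update_of_ne hYX] using Or.inr (h Y ⟨hY, hYX⟩)

/-- Along a winning strategy in the pebble game, corresponding assignments satisfy the same
formulas of the infinitary logic whose variables are injectively named by pebbles. -/
theorem InfFormula.sat_iff_of_strategy {s : ℕ} {E : Expansion A B}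
    {σ : DuplicatorStrategy s A B}
    (hσ : ∀ h, IsPartialIso L E {p | ∃ i, σ.position h i = some p})
    {V : Set ℕ} {f : ℕ → Fin s} (hf : Set.InjOn f V) {ρ : RelEnv A} {ρ' : RelEnv B}
    (φ : InfFormula.{u, v, w} L) (hV : φ.elemVars ⊆ V) (hρ : EnvsAgree E φ.relVars ρ ρ')
    (h : List (SpoilerMove s A B)) (α : ℕ → A) (β : ℕ → B)
    (hp : ∀ x ∈ φ.freeVars, σ.position h (f x) = some (α x, β x)) :
    φ.Sat ρ α ↔ φ.Sat ρ' β := by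
  induction φ generalizing h α β with
  | eq x y =>
    exact (hσ h).bij (α x, β x) ⟨f x, hp x (by simp [freeVars])⟩
      (α y, β y) ⟨f y, hp y (by simp [freeVars])⟩
  | rel P x =>
    exact (hσ h).rel P (fun i => (α (x i), β (x i)))
      fun i => ⟨f (x i), hp (x i) (by simp [freeVars])⟩
  | var X x =>
    exact (hσ h).exp _ (hρ X (by simp [relVars])) (fun i => (α (x i), β (x i)))
      fun i => ⟨f (x i), hp (x i) (by simp [freeVars])⟩
  | not φ ih => exact not_congr (ih hV hρ h α β hp)
  | conj φ ih =>
    exact forall_congr' fun i => ih i (fun x hx => hV (Set.mem_iUnion_of_mem i hx))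
      (hρ.mono (Set.subset_iUnion (fun i => (φ i).relVars) i)) h α β
      fun x hx => hp x (Set.mem_iUnion_of_mem i hx)
  | disj φ ih =>
    exact exists_congr fun i => ih i (fun x hx => hV (Set.mem_iUnion_of_mem i hx))
      (hρ.mono (Set.subset_iUnion (fun i => (φ i).relVars) i)) h α β
      fun x hx => hp x (Set.mem_iUnion_of_mem i hx)
  | ex x φ ih =>
    have hVφ : φ.elemVars ⊆ V := fun y hy => hV (Or.inr hy)
    -- The pebble of `x` can be reused because the old value of `x` is irrelevant below the
    -- quantifier; injectivity of `f` on `V` protects the pebbles of the other variables.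
    have key : ∀ (M : SpoilerMove s A B) (a : A) (b : B),
        σ.position (M :: h) = Function.update (σ.position h) (f x) (some (a, b)) →
        (φ.Sat ρ (Function.update α x a) ↔ φ.Sat ρ' (Function.update β x b)) := by
      intro M a b hM
      refine ih hVφ hρ (M :: h) _ _ fun y hy => ?_
      rw [hM]
      by_cases hyx : y = x
      · subst hyx
        simp
      · have hne : f y ≠ f x := fun e =>
          hyx (hf (hVφ (φ.freeVars_subset_elemVars hy)) (hV (Or.inl rfl)) e)
        simp only [Function.update_of_ne hne, Function.update_of_ne hyx]
        exact hp y ⟨hy, hyx⟩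
    constructor
    · rintro ⟨a, ha⟩
      exact ⟨_, (key (.left (f x) a) a _ rfl).1 ha⟩
    · rintro ⟨b, hb⟩
      exact ⟨_, (key (.right (f x) b) _ b rfl).2 hb⟩
  | all x φ ih =>
    have hVφ : φ.elemVars ⊆ V := fun y hy => hV (Or.inr hy)
    have key : ∀ (M : SpoilerMove s A B) (a : A) (b : B),
        σ.position (M :: h) = Function.update (σ.position h) (f x) (some (a, b)) →
        (φ.Sat ρ (Function.update α x a) ↔ φ.Sat ρ' (Function.update β x b)) := by
      intro M a b hM
      refine ih hVφ hρ (M :: h) _ _ fun y hy => ?_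
      rw [hM]
      by_cases hyx : y = x
      · subst hyx
        simp
      · have hne : f y ≠ f x := fun e =>
          hyx (hf (hVφ (φ.freeVars_subset_elemVars hy)) (hV (Or.inl rfl)) e)
        simp only [Function.update_of_ne hne, Function.update_of_ne hyx]
        exact hp y ⟨hy, hyx⟩
    constructor
    · exact fun H b => (key (.right (f x) b) _ b rfl).1 (H _)
    · exact fun H a => (key (.left (f x) a) a _ rfl).2 (H _)

theorem exists_injOn_fin {s : ℕ} (hs : 0 < s) {V : Set ℕ} (hV : V.encard ≤ s) :
    ∃ f : ℕ → Fin s, Set.InjOn f V := by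
  have : NeZero s := ⟨hs.ne'⟩
  have hfin : V.Finite := Set.finite_of_encard_le_coe hV
  obtain ⟨f, -, hf⟩ := hfin.exists_injOn_of_encard_le (t := (Set.univ : Set (Fin s))) (by
    simpa [Set.encard_univ] using hV)
  exact ⟨f, hf⟩

theorem WinsPebbleGame.sat_iff {s : ℕ} (hs : 0 < s) [Nonempty A] [Nonempty B]
    {E : Expansion A B} (hE : WinsPebbleGame L s E)
    (φ : InfFormula.{u, v, w} L) (hφ : φ.elemVars.encard ≤ s) (hfree : φ.freeVars = ∅)
    {ρ : RelEnv A} {ρ' : RelEnv B} (hρ : EnvsAgree E φ.relVars ρ ρ')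
    (α : ℕ → A) (β : ℕ → B) : φ.Sat ρ α ↔ φ.Sat ρ' β := by
  obtain ⟨σ, hσ⟩ := hE
  obtain ⟨f, hf⟩ := exists_injOn_fin hs hφ
  exact φ.sat_iff_of_strategy hσ hf subset_rfl hρ [] α β (by simp [hfree])

/-- If the duplicator survives `m` relation moves, then corresponding environments satisfy the
same formulas of log-quantifier rank at most `m`. -/
theorem WinsRelationMoves.sat_iff {r k s : ℕ} (hr : 0 < r) (hk : 0 < k) (hs : 0 < s)
    [Nonempty A] [Nonempty B] (φ : LogFormula.{u, v, w} L) {m : ℕ} {E : Expansion A B}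
    (hE : WinsRelationMoves L r k s m E) (hm : φ.lqr ≤ m)
    (hφr : ∀ X ∈ φ.relVars, (X.arity : ℕ) ≤ r) (hφk : φ.height ≤ k)
    (hφs : φ.elemVars.encard ≤ s) (hfree : φ.freeVars = ∅)
    {ρ : RelEnv A} {ρ' : RelEnv B} (hρ : EnvsAgree E φ.freeRelVars ρ ρ')
    (α : ℕ → A) (β : ℕ → B) : φ.Sat ρ α ↔ φ.Sat ρ' β := by
  induction φ generalizing m E ρ ρ' with
  -- The rank only bounds `m` from below, so relation moves may be left over; they are wasted here.
  | base φ => exact (hE.winsPebbleGame hr hk).sat_iff hs φ hφs hfree hρ α β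
  | exLog j X φ ih =>
    obtain ⟨m, rfl⟩ : ∃ n, m = n + 1 := ⟨m - 1, by simp only [LogFormula.lqr] at hm; omega⟩
    obtain ⟨h₁, h₂⟩ := hE X.arity j X.arity.pos (hφr X (Or.inl rfl)) j.pos
      ((le_max_left _ _).trans hφk)
    have step := fun (R : Set (Fin X.arity → A)) (S : Set (Fin X.arity → B))
      (hw : WinsRelationMoves L r k s m (⟨X.arity, R, S⟩ :: E)) =>
      ih hw (Nat.le_of_succ_le_succ hm) (fun Y hY => hφr Y (Or.inr hY))
        ((le_max_right _ _).trans hφk) hφs hfree (EnvsAgree.update hρ R S)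
    constructor
    · rintro ⟨R, hR, hsat⟩
      obtain ⟨S, hS, hw⟩ := h₁ R hR
      exact ⟨S, hS, (step R S hw).1 hsat⟩
    · rintro ⟨S, hS, hsat⟩
      obtain ⟨R, hR, hw⟩ := h₂ S hS
      exact ⟨R, hR, (step R S hw).2 hsat⟩
  | allLog j X φ ih =>
    obtain ⟨m, rfl⟩ : ∃ n, m = n + 1 := ⟨m - 1, by simp only [LogFormula.lqr] at hm; omega⟩
    obtain ⟨h₁, h₂⟩ := hE X.arity j X.arity.pos (hφr X (Or.inl rfl)) j.pos
      ((le_max_left _ _).trans hφk)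
    have step := fun (R : Set (Fin X.arity → A)) (S : Set (Fin X.arity → B))
      (hw : WinsRelationMoves L r k s m (⟨X.arity, R, S⟩ :: E)) =>
      ih hw (Nat.le_of_succ_le_succ hm) (fun Y hY => hφr Y (Or.inr hY))
        ((le_max_right _ _).trans hφk) hφs hfree (EnvsAgree.update hρ R S)
    constructor
    · intro H S hS
      obtain ⟨R, hR, hw⟩ := h₂ S hS
      exact (step R S hw).1 (H R hR)
    · intro H R hR
      obtain ⟨S, hS, hw⟩ := h₁ R hR
      exact (step R S hw).2 (H S hS)
  | and φ ψ ihφ ihψ =>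
    obtain ⟨hf₁, hf₂⟩ := Set.union_empty_iff.1 hfree
    exact and_congr
      (ihφ hE ((le_max_left _ _).trans hm) (fun Y hY => hφr Y (Or.inl hY))
        ((le_max_left _ _).trans hφk) ((Set.encard_le_encard Set.subset_union_left).trans hφs)
        hf₁ (hρ.mono Set.subset_union_left))
      (ihψ hE ((le_max_right _ _).trans hm) (fun Y hY => hφr Y (Or.inr hY))
        ((le_max_right _ _).trans hφk) ((Set.encard_le_encard Set.subset_union_right).trans hφs)
        hf₂ (hρ.mono Set.subset_union_right))
  | or φ ψ ihφ ihψ =>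
    obtain ⟨hf₁, hf₂⟩ := Set.union_empty_iff.1 hfree
    exact or_congr
      (ihφ hE ((le_max_left _ _).trans hm) (fun Y hY => hφr Y (Or.inl hY))
        ((le_max_left _ _).trans hφk) ((Set.encard_le_encard Set.subset_union_left).trans hφs)
        hf₁ (hρ.mono Set.subset_union_left))
      (ihψ hE ((le_max_right _ _).trans hm) (fun Y hY => hφr Y (Or.inr hY))
        ((le_max_right _ _).trans hφk) ((Set.encard_le_encard Set.subset_union_right).trans hφs)
        hf₂ (hρ.mono Set.subset_union_right))

theorem LogFormula.Mem.arity_le {φ : LogFormula.{u, v, w} L} {m r k s : ℕ} (h : φ.Mem m r k s)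
    {X : RelVar} (hX : X ∈ φ.relVars) : (X.arity : ℕ) ≤ r :=
  Nat.cast_le.1 (iSup₂_le_iff.1 h.mva_le X hX)

theorem DuplicatorWins.logicEquiv {m r k s : ℕ} (hr : 0 < r) (hk : 0 < k) (hs : 0 < s)
    [Nonempty A] [Nonempty B] (h : DuplicatorWins L A B m r k s) :
    LogicEquiv.{u, v, w} L A B m r k s := by
  intro φ hφ hmem
  have key : ∀ (ρ : RelEnv A) (ρ' : RelEnv B) (α : ℕ → A) (β : ℕ → B),
      φ.Sat ρ α ↔ φ.Sat ρ' β := fun ρ ρ' α β =>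
    (h m le_rfl).sat_iff hr hk hs φ hmem.lqr_le (fun _ => hmem.arity_le) hmem.height_le
      hmem.elemVars_le hφ.1 (by simp [EnvsAgree, hφ.2]) α β
  obtain ⟨a⟩ := ‹Nonempty A›
  obtain ⟨b⟩ := ‹Nonempty B›
  -- Truth quantifies over all environments and assignments, so nonemptiness is needed to have one
  -- to start from.
  exact ⟨fun H ρ' β => (key (fun _ => ∅) ρ' (fun _ => a) β).1 (H _ _),
    fun H ρ α => (key ρ (fun _ => ∅) α (fun _ => b)).2 (H _ _)⟩

end Soundness

/-! ### Separating formulas when the duplicator does not win. -/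

section Completeness

variable {L : FirstOrder.Language.{u, v}} {A : Type u₁} {B : Type u₂}

/-- A list of relation variables with interpretations on both structures. -/
abbrev Naming (A : Type u₁) (B : Type u₂) : Type (max u₁ u₂) :=
  List (Σ X : RelVar, Set (Fin X.arity → A) × Set (Fin X.arity → B))

namespace Naming

/-- The expansion by the named relations. -/
def expansion (Γ : Naming A B) : Expansion A B :=
  Γ.map fun c => ⟨c.1.arity, c.2⟩

/-- The relation variables that are given an interpretation. -/
def names (Γ : Naming A B) : Set RelVar :=
  {X | ∃ c ∈ Γ, c.1 = X}

/-- The environment on the left structure interprets the named variables as prescribed. -/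
def FitsLeft (Γ : Naming A B) (ρ : RelEnv A) : Prop :=
  ∀ c ∈ Γ, ρ c.1 = c.2.1

/-- The environment on the right structure interprets the named variables as prescribed. -/
def FitsRight (Γ : Naming A B) (ρ : RelEnv B) : Prop :=
  ∀ c ∈ Γ, ρ c.1 = c.2.2

/-- Freshness of `X` keeps the update from overwriting an earlier relation of `Γ`. -/
theorem FitsLeft.update {Γ : Naming A B} {ρ : RelEnv A} (h : Γ.FitsLeft ρ) {X : RelVar}
    (hX : X ∉ Γ.names) (R : Set (Fin X.arity → A)) (S : Set (Fin X.arity → B)) :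
    FitsLeft (⟨X, R, S⟩ :: Γ) (Function.update ρ X R) := by
  intro c hc
  rcases List.mem_cons.1 hc with rfl | hc
  · simp
  · rw [Function.update_of_ne fun e => hX ⟨c, hc, e⟩]
    exact h c hc

theorem FitsRight.update {Γ : Naming A B} {ρ : RelEnv B} (h : Γ.FitsRight ρ) {X : RelVar}
    (hX : X ∉ Γ.names) (R : Set (Fin X.arity → A)) (S : Set (Fin X.arity → B)) :
    FitsRight (⟨X, R, S⟩ :: Γ) (Function.update ρ X S) := by
  intro c hc
  rcases List.mem_cons.1 hc with rfl | hc
  · simp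
  · rw [Function.update_of_ne fun e => hX ⟨c, hc, e⟩]
    exact h c hc

theorem names_finite (Γ : Naming A B) : Γ.names.Finite :=
  (List.finite_toSet (Γ.map Sigma.fst)).subset fun _ ⟨c, hc, e⟩ =>
    List.mem_map.2 ⟨c, hc, e⟩

theorem exists_fresh (Γ : Naming A B) (n : ℕ+) : ∃ i : ℕ, (⟨n, i⟩ : RelVar) ∉ Γ.names := by
  have hinj : Function.Injective fun i : ℕ => (⟨n, i⟩ : RelVar) := fun i j h => by
    simpa using h
  obtain ⟨_, ⟨i, rfl⟩, hi⟩ :=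
    (Set.infinite_range_of_injective hinj).exists_notMem_finite Γ.names_finite
  exact ⟨i, hi⟩

theorem names_cons (c : Σ X : RelVar, Set (Fin X.arity → A) × Set (Fin X.arity → B))
    (Γ : Naming A B) : names (c :: Γ) = insert c.1 Γ.names := by
  ext X
  simp [names, eq_comm]

end Naming

/-- The duplicator wins the pebble game if she can maintain a condition that ensures partial
isomorphism. -/
theorem winsPebbleGame_of_invariant [L.Structure A] [L.Structure B] [Nonempty A] [Nonempty B]
    {s : ℕ} {E : Expansion A B} (Good : (Fin s → Option (A × B)) → Prop)
    (start : Good fun _ => none)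
    (iso : ∀ p, Good p → IsPartialIso L E {q | ∃ i, p i = some q})
    (forth : ∀ p, Good p → ∀ i a, ∃ b, Good (Function.update p i (some (a, b))))
    (back : ∀ p, Good p → ∀ i b, ∃ a, Good (Function.update p i (some (a, b)))) :
    WinsPebbleGame L s E := by
  -- Answers are made total, with an arbitrary element at bad positions, so that they can be chosen
  -- as functions of the position.
  have forth' : ∀ p i a, ∃ b, Good p → Good (Function.update p i (some (a, b))) := by
    intro p i a
    by_cases hp : Good p
    · exact (forth p hp i a).imp fun _ h _ => h
    · exact ⟨Classical.arbitrary B, fun h => absurd h hp⟩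
  have back' : ∀ p i b, ∃ a, Good p → Good (Function.update p i (some (a, b))) := by
    intro p i b
    by_cases hp : Good p
    · exact (back p hp i b).imp fun _ h _ => h
    · exact ⟨Classical.arbitrary A, fun h => absurd h hp⟩
  choose fB hfB using forth'
  choose fA hfA using back'
  -- The answers depend on the position alone, whereas a strategy sees the history; `pos` replays
  -- the history to recover the position.
  let pos : List (SpoilerMove s A B) → Fin s → Option (A × B) := fun h =>
    h.foldr (fun M p => match M with
      | .pass => p
      | .left i a => Function.update p i (some (a, fB p i a))
      | .right i b => Function.update p i (some (fA p i b, b))) fun _ => none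
  let σ : DuplicatorStrategy s A B := ⟨fun h => fB (pos h), fun h => fA (pos h)⟩
  have hpos : ∀ h, σ.position h = pos h := by
    intro h
    induction h with
    | nil => rfl
    | cons M h ih =>
      cases M <;> simp only [DuplicatorStrategy.position, ih] <;> rfl
  have hgood : ∀ h, Good (pos h) := by
    intro h
    induction h with
    | nil => exact start
    | cons M h ih =>
      cases M with
      | pass => exact ih
      | left i a => exact hfB _ i a ih
      | right i b => exact hfA _ i b ih
  exact ⟨σ, fun h => by simpa only [hpos] using iso _ (hgood h)⟩

/-! ### Inseparable positions as an invariant of the pebble game. -/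

variable {s : ℕ}

/-- The assignment gives the variable `i` the left element of the `i`-th pebble pair. -/
def AssignsLeft (p : Fin s → Option (A × B)) (α : ℕ → A) : Prop :=
  ∀ i q, p i = some q → α i = q.1

/-- The assignment gives the variable `i` the right element of the `i`-th pebble pair. -/
def AssignsRight (p : Fin s → Option (A × B)) (β : ℕ → B) : Prop :=
  ∀ i q, p i = some q → β i = q.2

theorem AssignsLeft.update {p : Fin s → Option (A × B)} {α : ℕ → A} (h : AssignsLeft p α)
    (i : Fin s) (a : A) (b : B) :
    AssignsLeft (Function.update p i (some (a, b))) (Function.update α i a) := by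
  intro j q hj
  by_cases hji : j = i
  · subst hji
    obtain rfl : (a, b) = q := by simpa using hj
    simp
  · rw [Function.update_of_ne hji] at hj
    rw [Function.update_of_ne fun e => hji (Fin.ext e)]
    exact h j q hj

theorem AssignsRight.update {p : Fin s → Option (A × B)} {β : ℕ → B} (h : AssignsRight p β)
    (i : Fin s) (a : A) (b : B) :
    AssignsRight (Function.update p i (some (a, b))) (Function.update β i b) := by
  intro j q hj
  by_cases hji : j = i
  · subst hji
    obtain rfl : (a, b) = q := by simpa using hj
    simp
  · rw [Function.update_of_ne hji] at hj
    rw [Function.update_of_ne fun e => hji (Fin.ext e)]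
    exact h j q hj

/-- The variables of the pebbles on the board. -/
def onBoard (p : Fin s → Option (A × B)) : Set ℕ :=
  {x | ∃ i q, p i = some q ∧ (i : ℕ) = x}

/-- Binding the variable `i` makes up for pebble `i`, which may have been off the board before the
move. -/
theorem onBoard_update_diff_subset (p : Fin s → Option (A × B)) (i : Fin s) (q : A × B) :
    onBoard (Function.update p i (some q)) \ {(i : ℕ)} ⊆ onBoard p := by
  rintro _ ⟨⟨j, q', hj, rfl⟩, hne⟩
  have hji : j ≠ i := fun e => hne (by rw [e]; rfl)
  rw [Function.update_of_ne hji] at hj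
  exact ⟨j, q', hj, rfl⟩

/-- The variables of the formula are named by the pebbles and by `Γ`, and its free element
variables are on the board. -/
structure InfFormula.Over (φ : InfFormula.{u, v, w} L) (Γ : Naming A B)
    (p : Fin s → Option (A × B)) : Prop where
  elemVars : φ.elemVars ⊆ Set.Iio s
  freeVars : φ.freeVars ⊆ onBoard p
  relVars : φ.relVars ⊆ Γ.names

variable [L.Structure A] [L.Structure B]

/-- The formula holds on the left and fails on the right at the given position. -/
structure InfFormula.Separates (φ : InfFormula.{u, v, w} L) (Γ : Naming A B)
    (p : Fin s → Option (A × B)) : Prop extends φ.Over Γ p where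
  left : ∀ ρ α, Γ.FitsLeft ρ → AssignsLeft p α → φ.Sat ρ α
  right : ∀ ρ β, Γ.FitsRight ρ → AssignsRight p β → ¬ φ.Sat ρ β

variable (L) in
/-- No formula of the infinitary logic separates the two sides of the position. -/
def Inseparable (Γ : Naming A B) (p : Fin s → Option (A × B)) : Prop :=
  ∀ φ : InfFormula.{u, v, w} L, ¬ φ.Separates Γ p

/-- Separation is one-sided, but the infinitary logic has negation: `φ` or its negation would
separate if `P` and `Q` differed. -/
theorem Inseparable.iff {Γ : Naming A B} {p : Fin s → Option (A × B)}
    (h : Inseparable.{u, v, w} L Γ p) (φ : InfFormula.{u, v, w} L) (hφ : φ.Over Γ p)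
    {P Q : Prop} (hP : ∀ ρ α, Γ.FitsLeft ρ → AssignsLeft p α → (φ.Sat ρ α ↔ P))
    (hQ : ∀ ρ β, Γ.FitsRight ρ → AssignsRight p β → (φ.Sat ρ β ↔ Q)) : P ↔ Q := by
  by_contra hPQ
  by_cases hp : P
  · have hq : ¬ Q := fun hq => hPQ ⟨fun _ => hq, fun _ => hp⟩
    exact h φ ⟨hφ, fun ρ α h₁ h₂ => (hP ρ α h₁ h₂).2 hp,
      fun ρ β h₁ h₂ H => hq ((hQ ρ β h₁ h₂).1 H)⟩
  · have hq : Q := by_contra fun hq => hPQ ⟨fun h => absurd h hp, fun h => absurd h hq⟩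
    exact h (.not φ) ⟨⟨hφ.elemVars, hφ.freeVars, hφ.relVars⟩,
      fun ρ α h₁ h₂ H => hp ((hP ρ α h₁ h₂).1 H),
      fun ρ β h₁ h₂ H => H ((hQ ρ β h₁ h₂).2 hq)⟩

/-- A failure would be witnessed by an atomic formula in the variables of the pebbles involved, or
by its negation. -/
theorem Inseparable.isPartialIso {Γ : Naming A B} {p : Fin s → Option (A × B)}
    (h : Inseparable.{u, v, w} L Γ p) :
    IsPartialIso L Γ.expansion {q | ∃ i, p i = some q} where
  bij := by
    rintro q ⟨i, hi⟩ q' ⟨j, hj⟩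
    refine h.iff (.eq i j) ⟨?_, ?_, Set.empty_subset _⟩ (fun ρ α _ hα => ?_) fun ρ β _ hβ => ?_
    · rintro x (rfl | rfl)
      exacts [i.2, j.2]
    · rintro x (rfl | rfl)
      exacts [⟨i, q, hi, rfl⟩, ⟨j, q', hj, rfl⟩]
    · simp only [InfFormula.Sat, hα i q hi, hα j q' hj]
    · simp only [InfFormula.Sat, hβ i q hi, hβ j q' hj]
  rel := by
    intro n P t ht
    choose i hi using ht
    refine h.iff (.rel P fun j => i j) ⟨?_, ?_, Set.empty_subset _⟩ (fun ρ α _ hα => ?_)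
      fun ρ β _ hβ => ?_
    · rintro _ ⟨j, rfl⟩
      exact (i j).2
    · rintro _ ⟨j, rfl⟩
      exact ⟨i j, t j, hi j, rfl⟩
    · simp only [InfFormula.Sat, fun j => hα (i j) _ (hi j)]
    · simp only [InfFormula.Sat, fun j => hβ (i j) _ (hi j)]
  exp := by
    intro Q hQ t ht
    obtain ⟨c, hc, rfl⟩ := List.mem_map.1 hQ
    choose i hi using ht
    refine h.iff (.var c.1 fun j => i j) ⟨?_, ?_, ?_⟩ (fun ρ α hρ hα => ?_)
      fun ρ β hρ hβ => ?_
    · rintro _ ⟨j, rfl⟩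
      exact (i j).2
    · rintro _ ⟨j, rfl⟩
      exact ⟨i j, t j, hi j, rfl⟩
    · rintro _ rfl
      exact ⟨c, hc, rfl⟩
    · simp only [InfFormula.Sat, fun j => hα (i j) _ (hi j), hρ c hc]
    · simp only [InfFormula.Sat, fun j => hβ (i j) _ (hi j), hρ c hc]

/-- If each answer `b` allowed a separating `φ b`, then `∃ xᵢ ⋀_b φ b` would separate at `p`: `a` is
a witness on the left, while on the right every `b` violates its own conjunct. -/
theorem Inseparable.forth [Finite B] {Γ : Naming A B} {p : Fin s → Option (A × B)}
    (h : Inseparable.{u, v, w} L Γ p) (i : Fin s) (a : A) :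
    ∃ b, Inseparable.{u, v, w} L Γ (Function.update p i (some (a, b))) := by
  by_contra! hcon
  simp only [Inseparable, not_forall, not_not] at hcon
  choose φ hφ using hcon
  obtain ⟨n, ⟨e⟩⟩ := Finite.exists_equiv_fin B
  -- Finiteness of `B` gives an index type for the conjunction in the universe `w`.
  refine h (.ex i (.conj fun j : ULift.{w} (Fin n) => φ (e.symm j.down)))
    ⟨⟨?_, ?_, ?_⟩, ?_, ?_⟩
  · exact Set.insert_subset i.2 (Set.iUnion_subset fun j => (hφ _).elemVars)
  · rintro x ⟨hx, hne⟩
    obtain ⟨j, hj⟩ := Set.mem_iUnion.1 hx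
    exact onBoard_update_diff_subset p i _ ⟨(hφ _).freeVars hj, hne⟩
  · exact Set.iUnion_subset fun j => (hφ _).relVars
  · exact fun ρ α hρ hα => ⟨a, fun j => (hφ _).left ρ _ hρ (hα.update i a _)⟩
  · rintro ρ β hρ hβ ⟨b, hb⟩
    have hb' := hb ⟨e b⟩
    simp only [Equiv.symm_apply_apply] at hb'
    exact (hφ b).right ρ _ hρ (hβ.update i a b) hb'

/-- Dual to `Inseparable.forth`: `∀ xᵢ ⋁_a φ a` holds on the left, each `a` satisfying its own
disjunct, and `b` refutes it on the right. -/
theorem Inseparable.back [Finite A] {Γ : Naming A B} {p : Fin s → Option (A × B)}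
    (h : Inseparable.{u, v, w} L Γ p) (i : Fin s) (b : B) :
    ∃ a, Inseparable.{u, v, w} L Γ (Function.update p i (some (a, b))) := by
  by_contra! hcon
  simp only [Inseparable, not_forall, not_not] at hcon
  choose φ hφ using hcon
  obtain ⟨n, ⟨e⟩⟩ := Finite.exists_equiv_fin A
  refine h (.all i (.disj fun j : ULift.{w} (Fin n) => φ (e.symm j.down)))
    ⟨⟨?_, ?_, ?_⟩, ?_, ?_⟩
  · exact Set.insert_subset i.2 (Set.iUnion_subset fun j => (hφ _).elemVars)
  · rintro x ⟨hx, hne⟩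
    obtain ⟨j, hj⟩ := Set.mem_iUnion.1 hx
    exact onBoard_update_diff_subset p i _ ⟨(hφ _).freeVars hj, hne⟩
  · exact Set.iUnion_subset fun j => (hφ _).relVars
  · intro ρ α hρ hα a
    refine ⟨⟨e a⟩, ?_⟩
    simp only [Equiv.symm_apply_apply]
    exact (hφ a).left ρ _ hρ (hα.update i a b)
  · intro ρ β hρ hβ H
    obtain ⟨j, hj⟩ := H b
    exact (hφ _).right ρ _ hρ (hβ.update i _ b) hj

theorem Inseparable.winsPebbleGame [Finite A] [Finite B] [Nonempty A] [Nonempty B]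
    {Γ : Naming A B} (h : Inseparable.{u, v, w} L Γ fun _ : Fin s => none) :
    WinsPebbleGame L s Γ.expansion :=
  winsPebbleGame_of_invariant (Inseparable.{u, v, w} L Γ) h (fun _ hp => hp.isPartialIso)
    (fun _ hp => hp.forth) fun _ hp => hp.back

/-! ### Finite combinations of formulas with log-quantifiers. -/

/-- The conjunction of a list of formulas. -/
def LogFormula.listConj (l : List (LogFormula.{u, v, w} L)) : LogFormula.{u, v, w} L :=
  l.foldr .and (.base (.conj (ι := PEmpty) PEmpty.elim))

/-- The disjunction of a list of formulas. -/
def LogFormula.listDisj (l : List (LogFormula.{u, v, w} L)) : LogFormula.{u, v, w} L :=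
  l.foldr .or (.base (.disj (ι := PEmpty) PEmpty.elim))

theorem LogFormula.sat_listConj {C : Type*} [L.Structure C] (l : List (LogFormula.{u, v, w} L))
    (ρ : RelEnv C) (α : ℕ → C) : (listConj l).Sat ρ α ↔ ∀ φ ∈ l, φ.Sat ρ α := by
  induction l with
  | nil => simp [listConj, Sat, InfFormula.Sat]
  | cons φ l ih =>
    rw [List.forall_mem_cons, ← ih]
    rfl

theorem LogFormula.sat_listDisj {C : Type*} [L.Structure C] (l : List (LogFormula.{u, v, w} L))
    (ρ : RelEnv C) (α : ℕ → C) : (listDisj l).Sat ρ α ↔ ∃ φ ∈ l, φ.Sat ρ α := by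
  induction l with
  | nil => simp [listDisj, Sat, InfFormula.Sat]
  | cons φ l ih =>
    rw [List.exists_mem_cons_iff, ← ih]
    rfl

/-- The formula obeys the parameters `m, r, k`, uses only the element variables below `s`, none of
them free, and its free relation variables lie in `N`. -/
structure LogFormula.Over (φ : LogFormula.{u, v, w} L) (m r k s : ℕ) (N : Set RelVar) :
    Prop where
  lqr : φ.lqr ≤ m
  relVars : ∀ X ∈ φ.relVars, (X.arity : ℕ) ≤ r
  height : φ.height ≤ k
  elemVars : φ.elemVars ⊆ Set.Iio s
  freeVars : φ.freeVars = ∅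
  freeRelVars : φ.freeRelVars ⊆ N

theorem LogFormula.Over.and {φ ψ : LogFormula.{u, v, w} L} {m r k s : ℕ} {N : Set RelVar}
    (hφ : φ.Over m r k s N) (hψ : ψ.Over m r k s N) : (φ.and ψ).Over m r k s N where
  lqr := max_le hφ.lqr hψ.lqr
  relVars := fun X hX => hX.elim (hφ.relVars X) (hψ.relVars X)
  height := max_le hφ.height hψ.height
  elemVars := Set.union_subset hφ.elemVars hψ.elemVars
  freeVars := Set.union_empty_iff.2 ⟨hφ.freeVars, hψ.freeVars⟩
  freeRelVars := Set.union_subset hφ.freeRelVars hψ.freeRelVars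

theorem LogFormula.Over.or {φ ψ : LogFormula.{u, v, w} L} {m r k s : ℕ} {N : Set RelVar}
    (hφ : φ.Over m r k s N) (hψ : ψ.Over m r k s N) : (φ.or ψ).Over m r k s N where
  lqr := max_le hφ.lqr hψ.lqr
  relVars := fun X hX => hX.elim (hφ.relVars X) (hψ.relVars X)
  height := max_le hφ.height hψ.height
  elemVars := Set.union_subset hφ.elemVars hψ.elemVars
  freeVars := Set.union_empty_iff.2 ⟨hφ.freeVars, hψ.freeVars⟩
  freeRelVars := Set.union_subset hφ.freeRelVars hψ.freeRelVars

theorem LogFormula.over_listConj {l : List (LogFormula.{u, v, w} L)} {m r k s : ℕ}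
    {N : Set RelVar} (h : ∀ φ ∈ l, φ.Over m r k s N) : (listConj l).Over m r k s N := by
  induction l with
  | nil =>
    constructor <;> simp [listConj, LogFormula.lqr, LogFormula.relVars, LogFormula.height,
      LogFormula.elemVars, LogFormula.freeVars, LogFormula.freeRelVars, InfFormula.relVars,
      InfFormula.elemVars, InfFormula.freeVars]
  | cons φ l ih =>
    exact (h φ List.mem_cons_self).and (ih fun ψ hψ => h ψ (List.mem_cons_of_mem _ hψ))

theorem LogFormula.over_listDisj {l : List (LogFormula.{u, v, w} L)} {m r k s : ℕ}
    {N : Set RelVar} (h : ∀ φ ∈ l, φ.Over m r k s N) : (listDisj l).Over m r k s N := by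
  induction l with
  | nil =>
    constructor <;> simp [listDisj, LogFormula.lqr, LogFormula.relVars, LogFormula.height,
      LogFormula.elemVars, LogFormula.freeVars, LogFormula.freeRelVars, InfFormula.relVars,
      InfFormula.elemVars, InfFormula.freeVars]
  | cons φ l ih =>
    exact (h φ List.mem_cons_self).or (ih fun ψ hψ => h ψ (List.mem_cons_of_mem _ hψ))

theorem LogFormula.Over.exLog {φ : LogFormula.{u, v, w} L} {m r k s : ℕ} {N N' : Set RelVar}
    (hφ : φ.Over m r k s N) {j : ℕ+} {X : RelVar} (hj : (j : ℕ) ≤ k) (hX : (X.arity : ℕ) ≤ r)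
    (hN : N \ {X} ⊆ N') : (φ.exLog j X).Over (m + 1) r k s N' where
  lqr := Nat.succ_le_succ hφ.lqr
  relVars := fun Y hY => hY.elim (fun e => e ▸ hX) (hφ.relVars Y)
  height := max_le hj hφ.height
  elemVars := hφ.elemVars
  freeVars := hφ.freeVars
  freeRelVars := (Set.sdiff_subset_sdiff_left hφ.freeRelVars).trans hN

theorem LogFormula.Over.allLog {φ : LogFormula.{u, v, w} L} {m r k s : ℕ} {N N' : Set RelVar}
    (hφ : φ.Over m r k s N) {j : ℕ+} {X : RelVar} (hj : (j : ℕ) ≤ k) (hX : (X.arity : ℕ) ≤ r)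
    (hN : N \ {X} ⊆ N') : (φ.allLog j X).Over (m + 1) r k s N' where
  lqr := Nat.succ_le_succ hφ.lqr
  relVars := fun Y hY => hY.elim (fun e => e ▸ hX) (hφ.relVars Y)
  height := max_le hj hφ.height
  elemVars := hφ.elemVars
  freeVars := hφ.freeVars
  freeRelVars := (Set.sdiff_subset_sdiff_left hφ.freeRelVars).trans hN

/-! ### Separating formulas for the relation moves. -/

/-- The formula holds on the left and fails on the right, whenever the environments are the
prescribed ones. -/
structure LogFormula.Separates (φ : LogFormula.{u, v, w} L)
    (m r k s : ℕ) (Γ : Naming A B) : Prop extends φ.Over m r k s Γ.names where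
  left : ∀ ρ (α : ℕ → A), Γ.FitsLeft ρ → φ.Sat ρ α
  right : ∀ ρ (β : ℕ → B), Γ.FitsRight ρ → ¬ φ.Sat ρ β

/-- If the spoiler wins, then a formula of the logic separates the two expanded structures. The
relation variables of the naming must have arities at most `r`. -/
theorem exists_separates [Finite A] [Finite B] [Nonempty A]
    [Nonempty B] {r k s m : ℕ} {Γ : Naming A B} (hΓ : ∀ X ∈ Γ.names, (X.arity : ℕ) ≤ r)
    (h : ¬ WinsRelationMoves L r k s m Γ.expansion) :
    ∃ φ : LogFormula.{u, v, w} L, φ.Separates m r k s Γ := by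
  induction m generalizing Γ with
  | zero =>
    have hsep : ¬ Inseparable.{u, v, w} L Γ fun _ : Fin s => none := fun H =>
      h H.winsPebbleGame
    simp only [Inseparable, not_forall, not_not] at hsep
    obtain ⟨φ, hφ⟩ := hsep
    refine ⟨.base φ, ⟨le_rfl, fun X hX => hΓ X (hφ.relVars hX), Nat.zero_le _, hφ.elemVars, ?_,
      hφ.relVars⟩, fun ρ α hρ => hφ.left ρ α hρ (by simp [AssignsLeft]),
      fun ρ β hρ => hφ.right ρ β hρ (by simp [AssignsRight])⟩
    exact Set.subset_empty_iff.1 (hφ.freeVars.trans (by simp [onBoard]))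
  | succ m ih =>
    simp only [WinsRelationMoves, not_forall] at h
    obtain ⟨r', k', hr', hr'r, hk', hk'k, h⟩ := h
    -- One fresh variable names the new pair for all answers, so that a single quantifier can bind
    -- it.
    obtain ⟨i, hX⟩ := Γ.exists_fresh ⟨r', hr'⟩
    set X : RelVar := ⟨⟨r', hr'⟩, i⟩
    have ih' : ∀ (R : Set (Fin X.arity → A)) (S : Set (Fin X.arity → B)),
        ¬ WinsRelationMoves L r k s m (⟨r', R, S⟩ :: Γ.expansion) →
        ∃ φ : LogFormula.{u, v, w} L, φ.Separates m r k s (⟨X, R, S⟩ :: Γ) := by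
      refine fun R S hRS => ih ?_ hRS
      rintro _ ⟨c, hc, rfl⟩
      rcases List.mem_cons.1 hc with rfl | hc
      · exact hr'r
      · exact hΓ _ ⟨c, hc, rfl⟩
    rw [not_and_or] at h
    rcases h with h | h
    · push Not at h
      obtain ⟨R, hR, h⟩ := h
      have hφ : ∀ S : {S : Set (Fin X.arity → B) // LogBounded k' S},
          ∃ φ : LogFormula.{u, v, w} L, φ.Separates m r k s (⟨X, R, S.1⟩ :: Γ) :=
        fun S => ih' R S.1 (h S.1 S.2)
      choose φ hφ using hφ
      have hl : ∀ ψ, ψ ∈ (Set.finite_range φ).toFinset.toList ↔ ∃ S, φ S = ψ := by simp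
      -- An unanswerable `R` on the left gives `∃^{log^k'} X ⋀_S φ S`. Only finitely many `S` exist,
      -- so binary conjunctions suffice.
      refine ⟨.exLog ⟨k', hk'⟩ X (.listConj (Set.finite_range φ).toFinset.toList),
        LogFormula.Over.exLog (N := insert X Γ.names) (LogFormula.over_listConj fun ψ hψ => ?_)
          hk'k hr'r (by simp), fun ρ α hρ => ⟨R, hR, ?_⟩, ?_⟩
      · obtain ⟨S, rfl⟩ := (hl ψ).1 hψ
        exact Naming.names_cons ⟨X, R, S.1⟩ Γ ▸ (hφ S).toOver
      · refine (LogFormula.sat_listConj _ _ _).2 fun ψ hψ => ?_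
        obtain ⟨S, rfl⟩ := (hl ψ).1 hψ
        exact (hφ S).left _ α (hρ.update hX R S)
      · rintro ρ β hρ ⟨S, hS, hsat⟩
        exact (hφ ⟨S, hS⟩).right _ β (hρ.update hX R S)
          ((LogFormula.sat_listConj _ _ _).1 hsat _ ((hl _).2 ⟨⟨S, hS⟩, rfl⟩))
    · push Not at h
      obtain ⟨S, hS, h⟩ := h
      have hφ : ∀ R : {R : Set (Fin X.arity → A) // LogBounded k' R},
          ∃ φ : LogFormula.{u, v, w} L, φ.Separates m r k s (⟨X, R.1, S⟩ :: Γ) :=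
        fun R => ih' R.1 S (h R.1 R.2)
      choose φ hφ using hφ
      have hl : ∀ ψ, ψ ∈ (Set.finite_range φ).toFinset.toList ↔ ∃ R, φ R = ψ := by simp
      -- An unanswerable `S` on the right gives `∀^{log^k'} X ⋁_R φ R`. Negating the previous case
      -- is not possible: negation may not be applied to log-quantifiers.
      refine ⟨.allLog ⟨k', hk'⟩ X (.listDisj (Set.finite_range φ).toFinset.toList),
        LogFormula.Over.allLog (N := insert X Γ.names) (LogFormula.over_listDisj fun ψ hψ => ?_)
          hk'k hr'r (by simp), fun ρ α hρ R hR => ?_, fun ρ β hρ hsat => ?_⟩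
      · obtain ⟨R, rfl⟩ := (hl ψ).1 hψ
        exact Naming.names_cons ⟨X, R.1, S⟩ Γ ▸ (hφ R).toOver
      · exact (LogFormula.sat_listDisj _ _ _).2 ⟨_, (hl _).2 ⟨⟨R, hR⟩, rfl⟩,
          (hφ ⟨R, hR⟩).left _ α (hρ.update hX R S)⟩
      · obtain ⟨ψ, hψ, hs⟩ := (LogFormula.sat_listDisj _ _ _).1 (hsat S hS)
        obtain ⟨R, rfl⟩ := (hl ψ).1 hψ
        exact (hφ R).right _ β (hρ.update hX R S) hs

theorem encard_Iio_nat (s : ℕ) : (Set.Iio s).encard = s := by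
  rw [← Finset.coe_Iio, Set.encard_coe_eq_coe_finsetCard, Nat.card_Iio]

theorem LogicEquiv.duplicatorWins [Finite A] [Finite B]
    [Nonempty A] [Nonempty B] {m r k s : ℕ} (h : LogicEquiv.{u, v, w} L A B m r k s) :
    DuplicatorWins L A B m r k s := by
  intro m' hm'
  by_contra hw
  -- With the empty naming, the separating formula has no free relation variables and is a sentence.
  obtain ⟨φ, hφ⟩ := exists_separates.{u, v, w} (Γ := []) (by simp [Naming.names]) hw
  have hiff := h φ ⟨hφ.freeVars, Set.subset_empty_iff.1
    (hφ.freeRelVars.trans (by simp [Naming.names]))⟩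
    ⟨hφ.lqr.trans hm', iSup₂_le fun X hX => Nat.cast_le.2 (hφ.relVars X hX), hφ.height,
      (Set.encard_le_encard hφ.elemVars).trans (encard_Iio_nat s).le⟩
  obtain ⟨b⟩ := ‹Nonempty B›
  exact hφ.right (fun _ => ∅) (fun _ => b) (by simp [Naming.FitsRight])
    (hiff.1 (fun ρ α => hφ.left ρ α (by simp [Naming.FitsLeft])) _ _)

end Completeness

end LogGame

theorem mainTheorem3 (m r k s : ℕ) (hr : 0 < r) (hk : 0 < k) (hs : 0 < s)
    (L : FirstOrder.Language.{u, v}) [L.IsRelational]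
    (A : Type u₁) (B : Type u₂) [L.Structure A] [L.Structure B]
    [Finite A] [Finite B] [Nonempty A] [Nonempty B] :
    LogGame.LogicEquiv.{u, v, w} L A B m r k s ↔ LogGame.DuplicatorWins L A B m r k s :=
  ⟨fun h => h.duplicatorWins, fun h => h.logicEquiv hr hk hs⟩
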